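/- Let $S$ be a closed, connected, orientable surface of genus at least $2$, equipped with a hyperbolic structure, with universal covering $p\colon\mathbb{H}^2\to S$ on which $\pi_1(S)=\pi_1(S,p(z_0))$ acts by deck transformations (orientation-preserving isometries). An oriented multi-curve on $S$ is a finite disjoint union of oriented circles with a continuous map to $S$, considered up to homotopy, orientation-preserving reparametrization, and adding or dropping components homotopic to a point; $\mathcal{C}^+(S)$ denotes the set of oriented multi-curves. For $C\in\mathcal{C}^+(S)$ and an integer $n\ge 0$, $C^n$ is the multi-curve obtained by replacing every component of $C$ by its $n$-fold cover (so $C^0$ is the empty multi-curve), and $nC$ is the union of $n$ parallel copies of $C$. For $a\in\pi_1(S)$ let $[a]$ be the oriented closed curve (free homotopy class) it represents, and write $[a][b]=[a]\cup[b]$. Let $f\colon\mathcal{C}^+(S)\to\mathbb{R}$ be a function satisfying: 1. (additivity) $f(C_1\cup C_2)=f(C_1)+f(C_2)$ for all $C_1,C_2\in\mathcal{C}^+(S)$; 2. (sub-stability) $f(C^{n+m})\ge f(C^m)+f(C^n)$ for all $C\in\mathcal{C}^+(S)$ and all integers $m,n\ge 0$; 3. (oriented disconnected smoothing) $f([a][b])\ge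 f([ab])$ for all $a,b\in\pi_1(S)$ whose hyperbolic axes in $\mathbb{H}^2$ cross, i.e. intersect in exactly one point. Then $f$ is stable: for every $C\in\mathcal{C}^+(S)$ and every integer $n\ge 1$, $f(C^n)=f(nC)=n\,f(C)$. -/

import Mathlib

open scoped UpperHalfPlane MatrixGroups

noncomputable section

/-! ### Oriented multi-curves -/

/-- A concrete oriented multi-curve on `S`: a finite disjoint union of oriented circles
together with a continuous map to `S`, recorded as the finite multiset of the restrictions of the
map to the components. The circle is `ℝ / ℤ` with its standard orientation. -/
abbrev ConcreteMultiCurve (S : Type*) [TopologicalSpace S] : Type _ :=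
  Multiset C(UnitAddCircle, S)

/-- The elementary moves on a single component: a free homotopy of the component, and
dropping a component that is homotopic to a point. (An orientation-preserving reparametrization of
a circle is homotopic to the identity, so reparametrizing a component is a free homotopy;
permuting components is already built into multisets.) -/
inductive MultiCurveMove (S : Type*) [TopologicalSpace S] :
    ConcreteMultiCurve S → ConcreteMultiCurve S → Prop
  | homotopy (γ γ' : C(UnitAddCircle, S)) (h : γ.Homotopic γ') : MultiCurveMove S {γ} {γ'}
  | drop (γ : C(UnitAddCircle, S)) (h : γ.Nullhomotopic) : MultiCurveMove S {γ} 0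

/-- Equivalence of concrete multi-curves: the equivalence relation generated by the moves, applied
to any of the components. -/
def multiCurveCon (S : Type*) [TopologicalSpace S] : AddCon (ConcreteMultiCurve S) :=
  addConGen (MultiCurveMove S)

/-- The space `𝒞⁺(S)` of oriented multi-curves. It is a commutative monoid: `C + D` is the union
`C ∪ D`, `0` is the empty multi-curve, and `n • C` is the multi-curve `n C` consisting of `n`
parallel copies of `C`. -/
abbrev OrientedMultiCurve (S : Type*) [TopologicalSpace S] : Type _ :=
  (multiCurveCon S).Quotient

namespace OrientedMultiCurve

variable {S : Type*} [TopologicalSpace S]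

/-- The oriented multi-curve represented by a single closed curve. -/
def ofLoop (γ : C(UnitAddCircle, S)) : OrientedMultiCurve S :=
  (({γ} : ConcreteMultiCurve S) : (multiCurveCon S).Quotient)

theorem ofLoop_eq_of_homotopic {γ γ' : C(UnitAddCircle, S)} (h : γ.Homotopic γ') :
    ofLoop γ = ofLoop γ' :=
  (AddCon.eq _).2 (AddConGen.Rel.of _ _ (MultiCurveMove.homotopy γ γ' h))

/-- The `n`-fold covering map `x ↦ n x` of the circle `ℝ / ℤ` by itself (constant for `n = 0`). -/
def circlePow (n : ℕ) : C(UnitAddCircle, UnitAddCircle) where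
  toFun x := n • x
  continuous_toFun := continuous_nsmul n

/-- On concrete multi-curves: precompose every component with the `n`-fold cover. -/
def concretePow (S : Type*) [TopologicalSpace S] (n : ℕ) :
    ConcreteMultiCurve S →+ ConcreteMultiCurve S :=
  Multiset.mapAddMonoidHom (fun γ => γ.comp (circlePow n))

theorem concretePow_rel (n : ℕ) :
    multiCurveCon S ≤
      AddCon.ker ((AddCon.mk' (multiCurveCon S)).comp (concretePow S n)) := by
  refine AddCon.addConGen_le.2 ?_
  intro x y hxy
  refine (AddCon.eq _).2 ?_
  cases hxy with
  | homotopy γ γ' h =>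
    exact AddConGen.Rel.of _ _
      (MultiCurveMove.homotopy _ _ (h.comp (ContinuousMap.Homotopic.refl _)))
  | drop γ h =>
    exact AddConGen.Rel.of _ _ (MultiCurveMove.drop _ (h.comp_left _))

/-- The multi-curve `C ^ n`: every component of `C` is replaced by its `n`-fold cover. -/
def power (n : ℕ) : OrientedMultiCurve S →+ OrientedMultiCurve S :=
  AddCon.lift (multiCurveCon S)
    ((AddCon.mk' (multiCurveCon S)).comp (concretePow S n)) (concretePow_rel n)

/-- The closed curve `ℝ / ℤ → S` obtained from a loop `[0, 1] → S` by gluing the endpoints. -/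
def circleOfPath {x : S} (q : Path x x) : C(UnitAddCircle, S) where
  toFun := AddCircle.liftIco 1 0 q.extend
  continuous_toFun :=
    AddCircle.liftIco_zero_continuous (by simp) q.continuous_extend.continuousOn

theorem circleOfPath_homotopic {x : S} {q q' : Path x x} (h : q.Homotopic q') :
    (circleOfPath q).Homotopic (circleOfPath q') := by
  obtain ⟨F⟩ := h
  -- for each position on the path, the track of that point during the homotopy
  let G : ℝ → C(unitInterval, S) := fun s =>
    (F : C(unitInterval × unitInterval, S)).comp
      ((ContinuousMap.id unitInterval).prodMk
        (ContinuousMap.const unitInterval (Set.projIcc (0 : ℝ) 1 zero_le_one s)))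
  have hGc : Continuous G := by
    refine ContinuousMap.continuous_of_continuous_uncurry _ ?_
    change Continuous fun y : ℝ × unitInterval =>
      F (y.2, Set.projIcc (0 : ℝ) 1 zero_le_one y.1)
    exact F.continuous.comp
      (continuous_snd.prodMk (continuous_projIcc.comp continuous_fst))
  have hG01 : G 0 = G 1 := by
    ext t
    change F (t, Set.projIcc (0 : ℝ) 1 zero_le_one 0) = F (t, Set.projIcc (0 : ℝ) 1 zero_le_one 1)
    rw [Set.projIcc_left, Set.projIcc_right]
    exact (F.source t).trans (F.target t).symm
  have hK : Continuous (AddCircle.liftIco (1 : ℝ) 0 G) :=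
    AddCircle.liftIco_zero_continuous hG01 hGc.continuousOn
  let K : C(UnitAddCircle, C(unitInterval, S)) := ⟨_, hK⟩
  refine ⟨⟨⟨fun y => K y.2 y.1, ?_⟩, ?_, ?_⟩⟩
  · exact (ContinuousMap.continuous_uncurry_of_continuous K).comp continuous_swap
  · intro x
    change F ((0 : unitInterval), Set.projIcc (0 : ℝ) 1 zero_le_one _) = q (Set.projIcc _ _ _ _)
    simp
  · intro x
    change F ((1 : unitInterval), Set.projIcc (0 : ℝ) 1 zero_le_one _) = q' (Set.projIcc _ _ _ _)
    simp

/-- The oriented closed curve `[a]` (a free homotopy class) determined by `a ∈ π₁(S, x)`. -/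
def ofFundamentalGroup {x : S} (a : FundamentalGroup S x) : OrientedMultiCurve S :=
  Quotient.lift (fun q : Path x x => ofLoop (circleOfPath q))
    (fun _ _ h => ofLoop_eq_of_homotopic (circleOfPath_homotopic h)) a.toPath

end OrientedMultiCurve

/-! ### Hyperbolic structures, axes and crossing -/

/-- A hyperbolic structure on an oriented surface `S`, given by its metric universal covering
`ℍ → S` by the hyperbolic plane: a surjective covering map all of whose deck transformations are
orientation-preserving isometries of `ℍ`, that is, Möbius transformations from `SL(2, ℝ)`.
The compact Hausdorff spaces that carry such a structure are exactly the
closed, connected, orientable surfaces of genus at least two. -/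
structure HyperbolicStructure (S : Type*) [TopologicalSpace S] where
  proj : C(ℍ, S)
  isCoveringMap_proj : IsCoveringMap proj
  surjective_proj : Function.Surjective proj
  deck_eq_moebius : ∀ T : ℍ ≃ₜ ℍ, (∀ z, proj (T z) = proj z) →
    ∃ g : SL(2, ℝ), ∀ z, T z = g • z

/-- The (underlying unoriented) axis of an isometry of `ℍ`: the set of points that it translates by
the least hyperbolic distance. For a hyperbolic isometry this is the geodesic of `ℍ` that it
leaves invariant. -/
def hyperbolicAxis (T : ℍ → ℍ) : Set ℍ :=
  {z | ∀ w, dist z (T z) ≤ dist w (T w)}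

namespace HyperbolicStructure

variable {S : Type*} [TopologicalSpace S] (Sig : HyperbolicStructure S)

/-- `T` is the deck transformation by which `a ∈ π₁(S, p(z₀))` acts on the universal cover `ℍ` with
basepoint `z₀`: it is a deck transformation, and `a` is the class of the
projection of a path from `z₀` to `T z₀`. -/
def IsDeckTransformationOf (z₀ : ℍ) (a : FundamentalGroup S (Sig.proj z₀)) (T : ℍ ≃ₜ ℍ) : Prop :=
  ∃ hT : ∀ z, Sig.proj (T z) = Sig.proj z, ∃ q : Path z₀ (T z₀),
    a = FundamentalGroup.fromPath
      (Path.Homotopic.Quotient.mk ((q.map Sig.proj.continuous).cast rfl (hT z₀).symm))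

/-- The axes of `a` and `b` cross: they intersect in exactly one point. (As the axes of
nontrivial elements are complete geodesics, this says that they are distinct and intersect; axes of
common powers coincide, and the minimal displacement set of the trivial element is all of `ℍ`, so
such pairs do not cross.) -/
def Crosses (z₀ : ℍ) (a b : FundamentalGroup S (Sig.proj z₀)) : Prop :=
  ∃ T U : ℍ ≃ₜ ℍ, Sig.IsDeckTransformationOf z₀ a T ∧ Sig.IsDeckTransformationOf z₀ b U ∧
    ∃ z, hyperbolicAxis T ∩ hyperbolicAxis U = {z}

end HyperbolicStructure

/-! ### Properties of curve functionals -/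

namespace CurveFunctional

variable {S : Type*} [TopologicalSpace S]

/-- Additivity: `f (C₁ ∪ C₂) = f (C₁) + f (C₂)`. -/
def Additive (f : OrientedMultiCurve S → ℝ) : Prop :=
  ∀ C₁ C₂, f (C₁ + C₂) = f C₁ + f C₂

/-- Sub-stability: `f (C ^ (n + m)) ≥ f (C ^ m) + f (C ^ n)` for all `m, n ≥ 0`. -/
def SubStable (f : OrientedMultiCurve S → ℝ) : Prop :=
  ∀ (C : OrientedMultiCurve S) (m n : ℕ),
    f (OrientedMultiCurve.power (n + m) C) ≥
      f (OrientedMultiCurve.power m C) + f (OrientedMultiCurve.power n C)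

/-- Stability: `f (C ^ n) = f (n C)` for all `n > 0`. -/
def Stable (f : OrientedMultiCurve S → ℝ) : Prop :=
  ∀ (C : OrientedMultiCurve S) (n : ℕ), 0 < n → f (OrientedMultiCurve.power n C) = f (n • C)

open OrientedMultiCurve in
/-- Oriented disconnected smoothing: `f ([a][b]) ≥ f ([ab])` for all `a, b` in the fundamental group
whose hyperbolic axes cross. (As `[ab] = [ba]`, the convention for composing loops is immaterial.)
-/
def OrientedDisconnectedSmoothing (Sig : HyperbolicStructure S) (z₀ : ℍ)
    (f : OrientedMultiCurve S → ℝ) : Prop :=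
  ∀ a b : FundamentalGroup S (Sig.proj z₀), Sig.Crosses z₀ a b →
    f (ofFundamentalGroup a + ofFundamentalGroup b) ≥ f (ofFundamentalGroup (a * b))

end CurveFunctional

end

/-!
Write `Γ` for the group of matrices in `SL(2, ℝ)` that act on `ℍ` as deck transformations, and `[g]`
for the closed curve in `S` covered by a path from a point `z` to `g z`, where `g ∈ Γ`. Every closed
curve is homotopic to some `[g]`, and its `n`-fold cover to `[g ^ n]`. As `f` is additive, it
suffices to prove `f [g ^ n] = n f [g]`, and `≥` is immediate from sub-stability.

For `≤`, suppose that `g` acts nontrivially, and choose `h ∈ Γ` whose axis crosses that of `g`. The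
axis of `g ^ k h` crosses that of `g` too, so smoothing gives
`f [g ^ (k + 1) h] ≤ f [g] + f [g ^ k h]`, hence `f [g ^ N h] ≤ N f [g] + f [h]`. The axis of
`g ^ N h` also crosses that of `h⁻¹`, so `f [g ^ N] ≤ f [g ^ N h] + f [h⁻¹] ≤ N f [g] + c`, where `c`
does not depend on `N` (`CurveFunctional.exists_pow_le`). Taking `N = n m`, the left-hand side is at
least `m f [g ^ n]`; dividing by `m` and letting `m → ∞` gives `f [g ^ n] ≤ n f [g]`.

The hyperbolic geometry is done with matrices. If `Q(z) = c |z|² + (d - a) Re z - b`, then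
`sinh² (d(z, g z) / 2) = (tr² g - 4) / 4 + (Q(z) / (2 Im z))²`, so that the axis of a hyperbolic `g`
is the zero set of `Q`. Two axes cross when `det (g h - h g) = 2 - tr [g, h]` is positive
(`Moebius.AxesCross.axes_inter`). This determinant does not change when `h` is replaced by `g ^ k h`,
or `(g, h)` by `(g h, h)`, and it acquires a positive factor when `g` is replaced by a positive power,
which gives the crossings used above.

The remaining input is the existence of `h` (`Moebius.exists_axesCross`). Compactness of `S` shows
that a nontrivial element of `Γ` moves every point by at least some fixed `ε > 0`, so it has
`tr² > 4`, and that every orbit of `Γ` comes uniformly close to every point of `ℍ`. Diagonalize `g`;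
an element crosses `g` exactly when the product of its off-diagonal entries is positive. The orbit of
`i` meets both sides of the axis of `g`, which is the imaginary axis. If all products of off-diagonal
entries were nonpositive, the signs forced on the entries of `x gⁿ y` for `n → ± ∞` would be
incompatible with this.
-/

noncomputable section

/-! ### Traces and commutators in `SL(2, ℝ)` -/

namespace Moebius

/-- The trace of a matrix in `SL(2, ℝ)`. -/
def tr (g : SL(2, ℝ)) : ℝ := g 0 0 + g 1 1

/-- The determinant of `g h - h g`, which equals `2 - tr (g h g⁻¹ h⁻¹)`. -/
def commDet (g h : SL(2, ℝ)) : ℝ :=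
  ((g : Matrix (Fin 2) (Fin 2) ℝ) * h - h * g).det

/-- Matrix form of the condition that `g` and `h` are hyperbolic and that their axes cross; the
geometric meaning is `Moebius.AxesCross.axes_inter`. -/
def AxesCross (g h : SL(2, ℝ)) : Prop :=
  4 < tr g ^ 2 ∧ 4 < tr h ^ 2 ∧ 0 < commDet g h

theorem det_entries (g : SL(2, ℝ)) : g 0 0 * g 1 1 - g 0 1 * g 1 0 = 1 := by
  have := g.det_coe
  rwa [Matrix.det_fin_two] at this

theorem commDet_eq (g h : SL(2, ℝ)) :
    commDet g h =
      -(g 0 1 * h 1 0 - g 1 0 * h 0 1) ^ 2 -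
        (g 0 1 * (h 1 1 - h 0 0) - (g 1 1 - g 0 0) * h 0 1) *
          (g 1 0 * (h 0 0 - h 1 1) - (g 0 0 - g 1 1) * h 1 0) := by
  simp only [commDet, Matrix.det_fin_two, Matrix.sub_apply, Matrix.mul_apply, Fin.sum_univ_two]
  ring

theorem commDet_swap (g h : SL(2, ℝ)) : commDet h g = commDet g h := by
  rw [commDet_eq, commDet_eq]; ring

theorem AxesCross.symm {g h : SL(2, ℝ)} (H : AxesCross g h) : AxesCross h g :=
  ⟨H.2.1, H.1, by rw [commDet_swap]; exact H.2.2⟩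

/-- For the quadratic form `tr² - 4` on traceless parts, the Gram determinant of `g` and `h` is
`4 det (g h - h g)`. -/
theorem tr_sq_sub_four_mul (g h : SL(2, ℝ)) :
    (tr g ^ 2 - 4) * (tr h ^ 2 - 4) =
      ((g 1 1 - g 0 0) * (h 1 1 - h 0 0) + 2 * (g 0 1 * h 1 0 + g 1 0 * h 0 1)) ^ 2
        + 4 * commDet g h := by
  have h1 : tr g ^ 2 - 4 = (g 1 1 - g 0 0) ^ 2 + 4 * (g 0 1 * g 1 0) := by
    have := det_entries g
    rw [tr]; linear_combination 4 * this
  have h2 : tr h ^ 2 - 4 = (h 1 1 - h 0 0) ^ 2 + 4 * (h 0 1 * h 1 0) := by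
    have := det_entries h
    rw [tr]; linear_combination 4 * this
  rw [h1, h2, commDet_eq]
  ring

theorem axesCross_of_commDet_pos {g h : SL(2, ℝ)} (hg : 4 < tr g ^ 2) (hc : 0 < commDet g h) :
    AxesCross g h := by
  refine ⟨hg, ?_, hc⟩
  have := tr_sq_sub_four_mul g h
  have h3 : 0 < (tr g ^ 2 - 4) * (tr h ^ 2 - 4) := by rw [this]; positivity
  have := pos_of_mul_pos_right h3 (by linarith)
  linarith

theorem commDet_mul_left (g h : SL(2, ℝ)) : commDet g (g * h) = commDet g h := by
  have : ((g : Matrix (Fin 2) (Fin 2) ℝ) * (g * h : SL(2, ℝ)) - (g * h : SL(2, ℝ)) * g) =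
      g * (g * h - h * g) := by
    rw [Matrix.SpecialLinearGroup.coe_mul]; noncomm_ring
  rw [commDet, this, Matrix.det_mul, g.det_coe, one_mul, commDet]

theorem commDet_conj (k g h : SL(2, ℝ)) :
    commDet (k⁻¹ * g * k) (k⁻¹ * h * k) = commDet g h := by
  have e : (k : Matrix (Fin 2) (Fin 2) ℝ) * (k⁻¹ : SL(2, ℝ)) = 1 := by
    rw [← Matrix.SpecialLinearGroup.coe_mul, mul_inv_cancel, Matrix.SpecialLinearGroup.coe_one]
  have key : ∀ K K' G H : Matrix (Fin 2) (Fin 2) ℝ, K * K' = 1 →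
      (K' * G * K) * (K' * H * K) - (K' * H * K) * (K' * G * K) = K' * (G * H - H * G) * K := by
    intro K K' G H hK
    have : ∀ X Y : Matrix (Fin 2) (Fin 2) ℝ, (K' * X * K) * (K' * Y * K) = K' * (X * Y) * K := by
      intro X Y
      calc _ = K' * X * (K * K') * Y * K := by noncomm_ring
        _ = _ := by rw [hK]; noncomm_ring
    rw [this, this]; noncomm_ring
  rw [commDet]
  simp only [Matrix.SpecialLinearGroup.coe_mul]
  rw [key _ _ _ _ e, Matrix.det_mul, Matrix.det_mul, Matrix.SpecialLinearGroup.det_coe,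
    Matrix.SpecialLinearGroup.det_coe, one_mul, mul_one, commDet]

theorem commDet_inv_right (g h : SL(2, ℝ)) : commDet g h⁻¹ = commDet g h := by
  rw [commDet_eq, commDet_eq g h]
  simp only [Matrix.SpecialLinearGroup.coe_inv, Matrix.adjugate_fin_two, Matrix.of_apply,
    Matrix.cons_val', Matrix.cons_val_zero, Matrix.cons_val_one, Matrix.cons_val_fin_one]
  ring

theorem commDet_pow_mul_left (g h : SL(2, ℝ)) (k : ℕ) : commDet g (g ^ k * h) = commDet g h := by
  induction k with
  | zero => simp
  | succ k ih => rw [pow_succ', mul_assoc, commDet_mul_left, ih]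

theorem commDet_mul_right (g h : SL(2, ℝ)) : commDet (g * h) h = commDet g h := by
  have : (((g * h : SL(2, ℝ)) : Matrix (Fin 2) (Fin 2) ℝ) * h - h * (g * h : SL(2, ℝ))) =
      (g * h - h * g) * h := by
    rw [Matrix.SpecialLinearGroup.coe_mul]; noncomm_ring
  rw [commDet, this, Matrix.det_mul, h.det_coe, mul_one, commDet]

/-- By Cayley–Hamilton, the powers of `g` are combinations `u g - v` with
`uₙ₊₁ = tr g * uₙ - uₙ₋₁`; since `|tr g| > 2`, the coefficients `|uₙ|` grow. -/
theorem exists_pow_entries (g : SL(2, ℝ)) (hg : 4 < tr g ^ 2) (n : ℕ) :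
    ∃ u v : ℝ, |v| + 1 ≤ |u| ∧
      ((g ^ (n + 1) : SL(2, ℝ)) : Matrix (Fin 2) (Fin 2) ℝ) =
        u • (g : Matrix (Fin 2) (Fin 2) ℝ) - v • 1 := by
  induction n with
  | zero => exact ⟨1, 0, by simp, by simp⟩
  | succ n ih =>
    obtain ⟨u, v, huv, h⟩ := ih
    have ht : 2 < |tr g| := by
      by_contra! hh
      have := sq_le_sq' (by linarith [abs_nonneg (tr g)]) hh
      rw [sq_abs] at this
      linarith
    refine ⟨tr g * u - v, u, ?_, ?_⟩
    · have h1 := abs_sub_abs_le_abs_sub (tr g * u) v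
      rw [abs_mul] at h1
      nlinarith [abs_nonneg u]
    · rw [pow_succ, Matrix.SpecialLinearGroup.coe_mul, h]
      have hCH : (g : Matrix (Fin 2) (Fin 2) ℝ) * g = tr g • (g : Matrix (Fin 2) (Fin 2) ℝ) - 1 := by
        have := det_entries g
        ext i j
        fin_cases i <;> fin_cases j <;>
          simp [Matrix.mul_apply, Fin.sum_univ_two, tr] <;>
          first | linear_combination -this | ring1
      rw [sub_mul, smul_mul_assoc, hCH, smul_sub, smul_smul, sub_smul, smul_mul_assoc, one_mul,
        mul_comm u]
      abel

theorem commDet_pow_pos {g h : SL(2, ℝ)} (hg : 4 < tr g ^ 2) (hc : 0 < commDet g h) (n : ℕ) :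
    0 < commDet (g ^ (n + 1)) h := by
  obtain ⟨u, v, huv, e⟩ := exists_pow_entries g hg n
  have hu : u ≠ 0 := by
    rintro rfl
    rw [abs_zero] at huv
    linarith [abs_nonneg v]
  have : commDet (g ^ (n + 1)) h = u ^ 2 * commDet g h := by
    rw [commDet, e]
    have : (u • (g : Matrix (Fin 2) (Fin 2) ℝ) - v • 1) * h
        - h * (u • (g : Matrix (Fin 2) (Fin 2) ℝ) - v • 1) = u • (g * h - h * g) := by
      simp only [sub_mul, mul_sub, smul_mul_assoc, mul_smul_comm, one_mul, mul_one, smul_sub]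
      abel
    rw [this, Matrix.det_smul, commDet]; simp
  rw [this]; positivity

theorem AxesCross.pow_mul {g h : SL(2, ℝ)} (H : AxesCross g h) (k : ℕ) :
    AxesCross g (g ^ k * h) :=
  axesCross_of_commDet_pos H.1 (by rw [commDet_pow_mul_left]; exact H.2.2)

theorem AxesCross.pow_mul_inv {g h : SL(2, ℝ)} (H : AxesCross g h) (n : ℕ) :
    AxesCross (g ^ (n + 1) * h) h⁻¹ := by
  have h1 : 0 < commDet (g ^ (n + 1) * h) h := by
    rw [commDet_mul_right]; exact commDet_pow_pos H.1 H.2.2 n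
  have h2 : AxesCross h (g ^ (n + 1) * h) :=
    axesCross_of_commDet_pos H.2.1 (by rwa [commDet_swap])
  exact axesCross_of_commDet_pos h2.2.1 (by rwa [commDet_inv_right])

/-! ### Displacement and axes in the hyperbolic plane -/

/-- The function `c |z|² + (d - a) Re z - b`, where `a, b, c, d` are the entries of `g`. If `g` is
hyperbolic, its zero set is the geodesic joining the fixed points of `g`. -/
def axisForm (g : SL(2, ℝ)) (z : ℍ) : ℝ :=
  g 1 0 * (z.re ^ 2 + z.im ^ 2) + (g 1 1 - g 0 0) * z.re - g 0 1

theorem sinh_sq_half_displacement (g : SL(2, ℝ)) (z : ℍ) :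
    Real.sinh (dist z (g • z) / 2) ^ 2 =
      (tr g ^ 2 - 4) / 4 + (axisForm g z / (2 * z.im)) ^ 2 := by
  have hden : (g 1 0 : ℂ) * z + g 1 1 ≠ 0 := by
    have := UpperHalfPlane.denom_ne_zero (g : GL (Fin 2) ℝ) z
    simpa [UpperHalfPlane.denom] using this
  have hco : ((g • z : ℍ) : ℂ) = ((g 0 0 : ℂ) * z + g 0 1) / ((g 1 0 : ℂ) * z + g 1 1) := by
    rw [UpperHalfPlane.coe_specialLinearGroup_apply]; simp
  have hz := z.im_pos
  have hN : 0 < Complex.normSq ((g 1 0 : ℂ) * z + g 1 1) := Complex.normSq_pos.2 hden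
  have him : (g • z).im = z.im / Complex.normSq ((g 1 0 : ℂ) * z + g 1 1) := by
    rw [← UpperHalfPlane.coe_im, hco, Complex.div_im]
    have := det_entries g
    simp
    field_simp
    linear_combination this
  have hd := det_entries g
  rw [UpperHalfPlane.sinh_half_dist, div_pow, mul_pow, Real.sq_sqrt (by positivity), him,
    Complex.dist_eq, hco, ← Complex.normSq_eq_norm_sq]
  have : (z : ℂ) - ((g 0 0 : ℂ) * z + g 0 1) / ((g 1 0 : ℂ) * z + g 1 1) =
      ((g 1 0 : ℂ) * z ^ 2 + (g 1 1 - g 0 0) * z - g 0 1) / ((g 1 0 : ℂ) * z + g 1 1) := by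
    rw [eq_div_iff hden, sub_mul, div_mul_cancel₀ _ hden]
    ring
  rw [this, Complex.normSq_div]
  have e : Complex.normSq ((g 1 0 : ℂ) * z ^ 2 + (g 1 1 - g 0 0) * z - g 0 1) =
      axisForm g z ^ 2 + z.im ^ 2 * (tr g ^ 2 - 4) := by
    rw [Complex.normSq_apply]
    simp [pow_two, axisForm, tr]
    linear_combination (-4 * z.im ^ 2) * hd
  rw [e]
  field_simp
  ring

theorem le_of_sinh_half_sq_le {x y : ℝ} (hy : 0 ≤ y)
    (h : Real.sinh (x / 2) ^ 2 ≤ Real.sinh (y / 2) ^ 2) : x ≤ y := by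
  have h1 : Real.sinh (x / 2) ≤ Real.sinh (y / 2) :=
    le_of_sq_le_sq h (Real.sinh_nonneg_iff.2 (by linarith))
  have := Real.sinh_le_sinh.1 h1
  linarith

theorem exists_axisForm_eq_zero {g : SL(2, ℝ)} (hg : 4 < tr g ^ 2) : ∃ z, axisForm g z = 0 := by
  have hd := det_entries g
  have hD : tr g ^ 2 - 4 = (g 1 1 - g 0 0) ^ 2 + 4 * (g 0 1 * g 1 0) := by
    rw [tr]; linear_combination 4 * hd
  by_cases hc : g 1 0 = 0
  · have : g 1 1 - g 0 0 ≠ 0 := by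
      intro h0
      rw [hc, h0] at hD
      linarith
    refine ⟨⟨⟨g 0 1 / (g 1 1 - g 0 0), 1⟩, by simp⟩, ?_⟩
    simp only [axisForm, hc, UpperHalfPlane.re, UpperHalfPlane.im]
    field_simp
    ring
  · refine ⟨⟨⟨(g 0 0 - g 1 1) / (2 * g 1 0), √((tr g ^ 2 - 4) / (4 * g 1 0 ^ 2))⟩, ?_⟩, ?_⟩
    · have : 0 < tr g ^ 2 - 4 := by linarith
      have : 0 < g 1 0 ^ 2 := by positivity
      simp only
      positivity
    · simp only [axisForm, UpperHalfPlane.re, UpperHalfPlane.im]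
      rw [Real.sq_sqrt (div_nonneg (by linarith) (by positivity)), hD]
      field_simp
      ring

theorem hyperbolicAxis_eq {g : SL(2, ℝ)} (hg : 4 < tr g ^ 2) :
    hyperbolicAxis (fun z => g • z) = {z | axisForm g z = 0} := by
  obtain ⟨z₀, hz₀⟩ := exists_axisForm_eq_zero hg
  ext z
  simp only [hyperbolicAxis, Set.mem_ofPred_eq]
  constructor
  · intro h
    have h1 := h z₀
    have h2 : Real.sinh (dist z (g • z) / 2) ^ 2 ≤ Real.sinh (dist z₀ (g • z₀) / 2) ^ 2 := by
      refine pow_le_pow_left₀ (Real.sinh_nonneg_iff.2 (by positivity)) ?_ 2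
      exact Real.sinh_le_sinh.2 (by linarith)
    rw [sinh_sq_half_displacement, sinh_sq_half_displacement, hz₀] at h2
    have h3 : (axisForm g z / (2 * z.im)) ^ 2 = 0 :=
      le_antisymm (by simpa using h2) (sq_nonneg _)
    have := z.im_pos.ne'
    simpa [this] using h3
  · intro h w
    refine le_of_sinh_half_sq_le dist_nonneg ?_
    rw [sinh_sq_half_displacement, sinh_sq_half_displacement, h]
    simp
    positivity

theorem AxesCross.axes_inter {g h : SL(2, ℝ)} (H : AxesCross g h) :
    ∃ z, hyperbolicAxis (fun z => g • z) ∩ hyperbolicAxis (fun z => h • z) = {z} := by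
  rw [hyperbolicAxis_eq H.1, hyperbolicAxis_eq H.2.1]
  have hΔ := H.2.2
  rw [commDet_eq] at hΔ
  set a := g 1 0
  set e := g 1 1 - g 0 0 with he
  set b := g 0 1
  set a' := h 1 0
  set e' := h 1 1 - h 0 0 with he'
  set b' := h 0 1
  have e1 : g 0 0 - g 1 1 = -e := by rw [he]; ring
  have e2 : h 0 0 - h 1 1 = -e' := by rw [he']; ring
  rw [e1, e2] at hΔ
  -- A point `z` lies on both axes iff `(|z|², Re z, 1)` is orthogonal to both coefficient vectors
  -- `(a, e, -b)` and `(a', e', -b')`, i.e. proportional to their cross product `(w₀, w₁, w₂)`.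
  -- Such a `z` exists in `ℍ` iff `w₁ ^ 2 < w₀ w₂`, and it is then unique.
  set w₀ := b * e' - e * b' with hw₀
  set w₁ := a' * -b - a * -b' with hw₁
  set w₂ := a * e' - e * a' with hw₂
  have hw : 0 < w₀ * w₂ - w₁ ^ 2 := by
    rw [hw₀, hw₁, hw₂]; linarith
  have hw₂0 : w₂ ≠ 0 := by
    intro h0
    rw [h0] at hw
    nlinarith [sq_nonneg w₁]
  have hpos : 0 < (w₀ * w₂ - w₁ ^ 2) / w₂ ^ 2 := by positivity
  refine ⟨⟨⟨w₁ / w₂, √((w₀ * w₂ - w₁ ^ 2) / w₂ ^ 2)⟩, by simpa using hpos⟩, ?_⟩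
  ext z
  simp only [Set.mem_inter_iff, Set.mem_ofPred_eq, Set.mem_singleton_iff, axisForm]
  change a * (z.re ^ 2 + z.im ^ 2) + e * z.re - b = 0 ∧
    a' * (z.re ^ 2 + z.im ^ 2) + e' * z.re - b' = 0 ↔ _
  constructor
  · rintro ⟨h1, h2⟩
    have hx : z.re = w₁ / w₂ := by
      rw [eq_div_iff hw₂0, hw₁, hw₂]
      linear_combination a * h2 - a' * h1
    have hy : z.re ^ 2 + z.im ^ 2 = w₀ / w₂ := by
      rw [eq_div_iff hw₂0, hw₀, hw₂]
      linear_combination e' * h1 - e * h2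
    have hy2 : z.im ^ 2 = (w₀ * w₂ - w₁ ^ 2) / w₂ ^ 2 := by
      rw [hx] at hy
      have : z.im ^ 2 = w₀ / w₂ - (w₁ / w₂) ^ 2 := by linarith
      rw [this]; field_simp
    apply UpperHalfPlane.ext
    apply Complex.ext
    · exact hx
    · change z.im = √((w₀ * w₂ - w₁ ^ 2) / w₂ ^ 2)
      rw [← hy2, Real.sqrt_sq z.im_pos.le]
  · rintro rfl
    simp only [UpperHalfPlane.re, UpperHalfPlane.im]
    rw [Real.sq_sqrt hpos.le]
    constructor
    · field_simp
      rw [hw₀, hw₁, hw₂]; ring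
    · field_simp
      rw [hw₀, hw₁, hw₂]; ring

/-- A matrix with `tr² ≤ 4` is elliptic, parabolic or scalar, so its displacement has infimum `0`. -/
theorem exists_displacement_lt {g : SL(2, ℝ)} (hg : tr g ^ 2 ≤ 4) {ε : ℝ} (hε : 0 < ε) :
    ∃ z : ℍ, dist z (g • z) < ε := by
  suffices ∃ z : ℍ, Real.sinh (dist z (g • z) / 2) ^ 2 < Real.sinh (ε / 2) ^ 2 by
    obtain ⟨z, hz⟩ := this
    refine ⟨z, not_le.1 fun h => not_le.2 hz ?_⟩
    refine pow_le_pow_left₀ (Real.sinh_nonneg_iff.2 (by positivity)) ?_ 2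
    exact Real.sinh_le_sinh.2 (by linarith)
  have hδ : 0 < Real.sinh (ε / 2) ^ 2 := by
    have : 0 < Real.sinh (ε / 2) := Real.sinh_pos_iff.2 (by positivity)
    positivity
  set δ := Real.sinh (ε / 2) ^ 2
  simp only [sinh_sq_half_displacement]
  have hd := det_entries g
  have hD : tr g ^ 2 - 4 = (g 1 1 - g 0 0) ^ 2 + 4 * (g 0 1 * g 1 0) := by
    rw [tr]; linear_combination 4 * hd
  by_cases hc : g 1 0 = 0
  · rw [hc] at hD
    have h0 : g 1 1 - g 0 0 = 0 := by
      have : (g 1 1 - g 0 0) ^ 2 ≤ 0 := by linarith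
      exact pow_eq_zero_iff two_ne_zero |>.1 (le_antisymm this (sq_nonneg _))
    rw [h0] at hD
    -- `g` acts as the translation by `± g 0 1`, whose displacement at height `y` tends to `0`
    have hq : 0 < √δ := by positivity
    refine ⟨⟨⟨0, (|g 0 1| + 1) / √δ⟩, by simp only; positivity⟩, ?_⟩
    simp only [axisForm, hc, h0, UpperHalfPlane.re, UpperHalfPlane.im]
    rw [hD]
    have : ((0 * (0 ^ 2 + ((|g 0 1| + 1) / √δ) ^ 2) + 0 * 0 - g 0 1) / (2 * ((|g 0 1| + 1) / √δ))) ^ 2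
        = δ * (g 0 1 ^ 2 / (4 * (|g 0 1| + 1) ^ 2)) := by
      field_simp
      rw [Real.sq_sqrt hδ.le]
      ring
    rw [this]
    have h4 : g 0 1 ^ 2 / (4 * (|g 0 1| + 1) ^ 2) < 1 := by
      rw [div_lt_one (by positivity), ← sq_abs (g 0 1)]
      nlinarith [abs_nonneg (g 0 1)]
    nlinarith
  · by_cases h0 : tr g ^ 2 - 4 = 0
    -- parabolic: approach the fixed point vertically
    · have hc2 : 0 < |g 1 0| := by positivity
      have hq : 0 < √δ := by positivity
      refine ⟨⟨⟨(g 0 0 - g 1 1) / (2 * g 1 0), √δ / |g 1 0|⟩, by simp only; positivity⟩, ?_⟩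
      rw [h0]
      have : axisForm g ⟨⟨(g 0 0 - g 1 1) / (2 * g 1 0), √δ / |g 1 0|⟩, by simp only; positivity⟩
          = g 1 0 * (√δ / |g 1 0|) ^ 2 := by
        simp only [axisForm, UpperHalfPlane.re, UpperHalfPlane.im]
        rw [hD] at h0
        field_simp
        linear_combination (-|g 1 0| ^ 2) * h0
      rw [this]
      simp only [UpperHalfPlane.im]
      have h5 : (g 1 0 * (√δ / |g 1 0|) ^ 2 / (2 * (√δ / |g 1 0|))) ^ 2 = δ / 4 := by
        have : (g 1 0 * (√δ / |g 1 0|) ^ 2 / (2 * (√δ / |g 1 0|))) =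
            g 1 0 / |g 1 0| * (√δ / 2) := by field_simp
        rw [this, mul_pow, div_pow, div_pow, sq_abs, Real.sq_sqrt hδ.le]
        field_simp; norm_num
      rw [h5]; linarith
    · have hneg : 0 < 4 - tr g ^ 2 := lt_of_le_of_ne (by linarith) (fun h => h0 (by linarith))
      have hc2 : 0 < g 1 0 ^ 2 := by positivity
      -- elliptic: the fixed point in `ℍ`
      refine ⟨⟨⟨(g 0 0 - g 1 1) / (2 * g 1 0), √((4 - tr g ^ 2) / (4 * g 1 0 ^ 2))⟩,
        by simp only; positivity⟩, ?_⟩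
      simp only [axisForm, UpperHalfPlane.re, UpperHalfPlane.im]
      rw [div_pow, mul_pow, Real.sq_sqrt (by positivity)]
      have h6 : 4 - tr g ^ 2 = - ((g 1 1 - g 0 0) ^ 2 + 4 * (g 0 1 * g 1 0)) := by linarith
      have h7 : (g 1 0 * (((g 0 0 - g 1 1) / (2 * g 1 0)) ^ 2 + (4 - tr g ^ 2) / (4 * g 1 0 ^ 2)) +
          (g 1 1 - g 0 0) * ((g 0 0 - g 1 1) / (2 * g 1 0)) - g 0 1) =
          (4 - tr g ^ 2) / (2 * g 1 0) := by
        rw [h6]; field_simp; ring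
      rw [h7]
      have h8 : (tr g ^ 2 - 4) / 4 + ((4 - tr g ^ 2) / (2 * g 1 0)) ^ 2 /
          (2 ^ 2 * ((4 - tr g ^ 2) / (4 * g 1 0 ^ 2))) = 0 := by
        field_simp; ring
      rw [h8]; exact hδ

end Moebius

/-! ### Existence of crossing axes -/

namespace Moebius
open Filter Topology

theorem mul_entry (g h : SL(2, ℝ)) (i j : Fin 2) :
    (g * h) i j = g i 0 * h 0 j + g i 1 * h 1 j := by
  simp [Matrix.SpecialLinearGroup.coe_mul, Matrix.mul_apply, Fin.sum_univ_two]

theorem inv_entries (g : SL(2, ℝ)) :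
    g⁻¹ 0 0 = g 1 1 ∧ g⁻¹ 0 1 = -g 0 1 ∧ g⁻¹ 1 0 = -g 1 0 ∧ g⁻¹ 1 1 = g 0 0 := by
  simp [Matrix.SpecialLinearGroup.coe_inv, Matrix.adjugate_fin_two]

theorem pow_entries_of_diagonal {d : SL(2, ℝ)} (h01 : d 0 1 = 0) (h10 : d 1 0 = 0) (n : ℕ) :
    (d ^ n) 0 0 = d 0 0 ^ n ∧ (d ^ n) 0 1 = 0 ∧ (d ^ n) 1 0 = 0 ∧ (d ^ n) 1 1 = d 1 1 ^ n := by
  induction n with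
  | zero => simp
  | succ n ih =>
    obtain ⟨h1, h2, h3, h4⟩ := ih
    rw [pow_succ]
    simp only [mul_entry, h1, h2, h3, h4, h01, h10]
    refine ⟨by ring, by ring, by ring, by ring⟩

/-- If all products of off-diagonal entries in `Γ` are nonpositive, then so is the leading term of
that product for `g dⁿ h` as `n → ∞`, where `d` is diagonal. -/
theorem mul_nonpos_of_expanding {Γ : Subgroup SL(2, ℝ)} (hΓ : ∀ g ∈ Γ, g 0 1 * g 1 0 ≤ 0)
    {d : SL(2, ℝ)} (hd : d ∈ Γ) (h01 : d 0 1 = 0) (h10 : d 1 0 = 0) {g h : SL(2, ℝ)}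
    (hg : g ∈ Γ) (hh : h ∈ Γ) :
    (|d 1 1| < 1 → g 0 0 * g 1 0 * (h 0 0 * h 0 1) ≤ 0) ∧
      (|d 0 0| < 1 → g 0 1 * g 1 1 * (h 1 0 * h 1 1) ≤ 0) := by
  have hdet := det_entries d
  rw [h01, zero_mul, sub_zero] at hdet
  have key : ∀ n : ℕ, (g 0 0 * d 0 0 ^ n * h 0 1 + g 0 1 * d 1 1 ^ n * h 1 1) *
      (g 1 0 * d 0 0 ^ n * h 0 0 + g 1 1 * d 1 1 ^ n * h 1 0) ≤ 0 := by
    intro n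
    have := hΓ _ (Γ.mul_mem (Γ.mul_mem hg (Γ.pow_mem hd n)) hh)
    obtain ⟨h1, h2, h3, h4⟩ := pow_entries_of_diagonal h01 h10 n
    simp only [mul_entry, h1, h2, h3, h4] at this
    linarith
  have hpow : ∀ n : ℕ, d 0 0 ^ n * d 1 1 ^ n = 1 := fun n => by rw [← mul_pow, hdet, one_pow]
  constructor
  -- multiplied by `(d 1 1) ^ (2 n)`, the product is a polynomial in that power, which tends to `0`
  · intro hlt
    have ht : Tendsto (fun n : ℕ => (d 1 1 ^ n) ^ 2) atTop (𝓝 (0 ^ 2)) :=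
      (tendsto_pow_atTop_nhds_zero_of_abs_lt_one hlt).pow 2
    have hlim := ((ht.const_mul (g 0 1 * h 1 1)).const_add (g 0 0 * h 0 1)).mul
      ((ht.const_mul (g 1 1 * h 1 0)).const_add (g 1 0 * h 0 0))
    have := le_of_tendsto' hlim (b := 0) fun n => by
      have h1 := mul_nonpos_of_nonpos_of_nonneg (key n) (sq_nonneg (d 1 1 ^ n))
      have h2 := hpow n
      refine le_of_eq_of_le ?_ h1
      generalize d 1 1 ^ n = y at *
      generalize d 0 0 ^ n = x at *
      linear_combination
        (-(g 0 0 * h 0 1 * (g 1 0 * h 0 0)) * (x * y + 1)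
          - (g 0 0 * h 0 1 * (g 1 1 * h 1 0) + g 1 0 * h 0 0 * (g 0 1 * h 1 1)) * y ^ 2) * h2
    linarith
  · intro hlt
    have ht : Tendsto (fun n : ℕ => (d 0 0 ^ n) ^ 2) atTop (𝓝 (0 ^ 2)) :=
      (tendsto_pow_atTop_nhds_zero_of_abs_lt_one hlt).pow 2
    have hlim := ((ht.const_mul (g 0 0 * h 0 1)).const_add (g 0 1 * h 1 1)).mul
      ((ht.const_mul (g 1 0 * h 0 0)).const_add (g 1 1 * h 1 0))
    have := le_of_tendsto' hlim (b := 0) fun n => by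
      have h1 := mul_nonpos_of_nonpos_of_nonneg (key n) (sq_nonneg (d 0 0 ^ n))
      have h2 := hpow n
      refine le_of_eq_of_le ?_ h1
      generalize d 1 1 ^ n = y at *
      generalize d 0 0 ^ n = x at *
      linear_combination
        (-(g 0 1 * h 1 1 * (g 1 1 * h 1 0)) * (x * y + 1)
          - (g 0 0 * h 0 1 * (g 1 1 * h 1 0) + g 1 0 * h 0 0 * (g 0 1 * h 1 1)) * x ^ 2) * h2
    linarith

theorem commDet_of_diagonal {d : SL(2, ℝ)} (h01 : d 0 1 = 0) (h10 : d 1 0 = 0) (g : SL(2, ℝ)) :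
    commDet d g = (d 0 0 - d 1 1) ^ 2 * (g 0 1 * g 1 0) := by
  rw [commDet_eq, h01, h10]; ring

/-- An element that shares a fixed point with the diagonal element `d` (a zero off-diagonal entry)
is itself diagonal: otherwise its commutator with `d` would be parabolic. -/
theorem offDiagonal_eq_zero {Γ : Subgroup SL(2, ℝ)}
    (hell : ∀ g ∈ Γ, tr g ^ 2 ≤ 4 → g 0 1 = 0 ∧ g 1 0 = 0)
    {d : SL(2, ℝ)} (hd : d ∈ Γ) (h01 : d 0 1 = 0) (h10 : d 1 0 = 0) (hne : d 0 0 ^ 2 ≠ 1)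
    {g : SL(2, ℝ)} (hg : g ∈ Γ) (h0 : g 0 1 * g 1 0 = 0) : g 0 1 = 0 ∧ g 1 0 = 0 := by
  have hdet := det_entries d
  rw [h01, zero_mul, sub_zero] at hdet
  have hgdet := det_entries g
  rw [h0, sub_zero] at hgdet
  obtain ⟨e1, e2, e3, e4⟩ := inv_entries g
  obtain ⟨f1, f2, f3, f4⟩ := inv_entries d
  have hc := hell (d * g * d⁻¹ * g⁻¹)
    (Γ.mul_mem (Γ.mul_mem (Γ.mul_mem hd hg) (Γ.inv_mem hd)) (Γ.inv_mem hg))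
  simp only [tr, mul_entry, e1, e2, e3, e4, f1, f2, f3, f4, h01, h10] at hc
  have hd0 : d 0 0 ≠ 0 := left_ne_zero_of_mul_eq_one hdet
  have hd1 : d 1 1 ^ 2 ≠ 1 := by
    intro h
    apply hne
    have : (d 0 0 * d 1 1) ^ 2 = 1 := by rw [hdet]; norm_num
    rwa [mul_pow, h, mul_one] at this
  have hp : g 0 0 ≠ 0 := left_ne_zero_of_mul_eq_one hgdet
  have hs : g 1 1 ≠ 0 := right_ne_zero_of_mul_eq_one hgdet
  -- as `g 0 1 * g 1 0 = 0`, the commutator of `d` and `g` has trace `2`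
  obtain ⟨c1, c2⟩ := hc (le_of_eq (by
    have : ∀ x : ℝ, x = 2 → x ^ 2 = 4 := by rintro _ rfl; norm_num
    apply this
    linear_combination (-(d 0 0) ^ 2 - d 1 1 ^ 2) * h0 + (2 * d 0 0 * d 1 1) * hgdet + 2 * hdet))
  constructor
  · have : g 0 0 * g 0 1 * (d 0 0 ^ 2 - 1) = 0 := by
      linear_combination c1 + g 0 0 * g 0 1 * hdet
    rcases mul_eq_zero.1 this with h | h
    · exact (mul_eq_zero.1 h).resolve_left hp
    · exact absurd (sub_eq_zero.1 h) hne
  · have : g 1 0 * g 1 1 * (d 1 1 ^ 2 - 1) = 0 := by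
      linear_combination c2 + g 1 0 * g 1 1 * hdet
    rcases mul_eq_zero.1 this with h | h
    · exact (mul_eq_zero.1 h).resolve_right hs
    · exact absurd (sub_eq_zero.1 h) hd1

/-- The hypotheses on `g` and `h` say that `g • i` and `h • i` lie on different sides of the imaginary
axis, which is the axis of `d`. The conclusion says that the axis of `b` crosses it. -/
theorem exists_mul_pos {Γ : Subgroup SL(2, ℝ)}
    (hell : ∀ g ∈ Γ, tr g ^ 2 ≤ 4 → g 0 1 = 0 ∧ g 1 0 = 0)
    {d : SL(2, ℝ)} (hd : d ∈ Γ) (h01 : d 0 1 = 0) (h10 : d 1 0 = 0) (hne : d 0 0 ^ 2 ≠ 1)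
    {g h : SL(2, ℝ)} (hg : g ∈ Γ) (hh : h ∈ Γ)
    (hgpos : 0 < g 0 0 * g 1 0 + g 0 1 * g 1 1)
    (hhneg : h 0 0 * h 1 0 + h 0 1 * h 1 1 < 0) : ∃ b ∈ Γ, 0 < b 0 1 * b 1 0 := by
  by_contra! hΓ
  have hdet := det_entries d
  rw [h01, zero_mul, sub_zero] at hdet
  obtain ⟨f1, f2, f3, f4⟩ := inv_entries d
  have hd0 : d 0 0 ≠ 0 := left_ne_zero_of_mul_eq_one hdet
  have hAB : ∀ x ∈ Γ, ∀ y ∈ Γ, x 0 0 * x 1 0 * (y 0 0 * y 0 1) ≤ 0 ∧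
      x 0 1 * x 1 1 * (y 1 0 * y 1 1) ≤ 0 := by
    intro x hx y hy
    have A := mul_nonpos_of_expanding hΓ hd h01 h10 hx hy
    have B := mul_nonpos_of_expanding hΓ (Γ.inv_mem hd) (by rw [f2, h01, neg_zero])
      (by rw [f3, h10, neg_zero]) hx hy
    rw [f1, f4] at B
    have habs : |d 0 0| * |d 1 1| = 1 := by rw [← abs_mul, hdet, abs_one]
    have hd0' : 0 < |d 0 0| := abs_pos.2 hd0
    have hone : |d 0 0| ≠ 1 := by
      intro h; apply hne; rw [← sq_abs, h, one_pow]
    rcases lt_or_gt_of_ne hone with h1 | h1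
    · exact ⟨B.1 h1, A.2 h1⟩
    · have h2 : |d 1 1| < 1 := by
        by_contra! h2
        nlinarith
      exact ⟨A.1 h2, B.2 h2⟩
  have hlt : ∀ x ∈ Γ, x 0 0 * x 1 0 + x 0 1 * x 1 1 ≠ 0 → x 0 1 * x 1 0 < 0 := by
    intro x hx hx0
    refine lt_of_le_of_ne (hΓ x hx) fun h => hx0 ?_
    obtain ⟨h1, h2⟩ := offDiagonal_eq_zero hell hd h01 h10 hne hx h
    rw [h1, h2]; ring
  have hg1 := hlt g hg hgpos.ne'
  have hh1 := hlt h hh hhneg.ne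
  obtain ⟨g1, g2, g3, g4⟩ := inv_entries g
  obtain ⟨h1, h2, h3, h4⟩ := inv_entries h
  -- the sign conditions for `g * g⁻¹`, `h * h⁻¹`, `g * h⁻¹` with powers of `d` in between, and for
  -- `g * h`, written below with `g = !![p, q; r, s]` and `h = !![p', q'; r', s']`
  have a1 := (hAB g hg _ (Γ.inv_mem hg)).1
  have a2 := (hAB h hh _ (Γ.inv_mem hh)).1
  have a3 := (hAB g hg _ (Γ.inv_mem hh)).1
  have a4 := (hAB g hg _ (Γ.inv_mem hh)).2
  have a5 := hΓ _ (Γ.mul_mem hg hh)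
  simp only [mul_entry, g1, g2, h1, h2, h3, h4] at a1 a2 a3 a4 a5
  clear hAB hΓ hlt hell g1 g2 g3 g4 h1 h2 h3 h4
  generalize g 0 0 = p at *
  generalize g 0 1 = q at *
  generalize g 1 0 = r at *
  generalize g 1 1 = s at *
  generalize h 0 0 = p' at *
  generalize h 0 1 = q' at *
  generalize h 1 0 = r' at *
  generalize h 1 1 = s' at *
  have hr : r ≠ 0 := right_ne_zero_of_mul hg1.ne
  have hq : q ≠ 0 := left_ne_zero_of_mul hg1.ne
  have hr' : r' ≠ 0 := right_ne_zero_of_mul hh1.ne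
  have hq' : q' ≠ 0 := left_ne_zero_of_mul hh1.ne
  -- `p r` and `q s` have equal signs, so both are `≥ 0` as their sum is positive; similarly,
  -- `p' r'` and `q' s'` are `≤ 0`
  have b1 : 0 ≤ (p * r) * (q * s) := by linarith
  have b2 : 0 ≤ (p' * r') * (q' * s') := by linarith
  have c1 : 0 ≤ p * r := by by_contra! hn; nlinarith
  have c2 : 0 ≤ q * s := by by_contra! hn; nlinarith
  have c3 : p' * r' ≤ 0 := by by_contra! hn; nlinarith
  have c4 : q' * s' ≤ 0 := by by_contra! hn; nlinarith
  have d1 : (p * r) * (q' * s') = 0 :=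
    le_antisymm (mul_nonpos_of_nonneg_of_nonpos c1 c4) (by linarith)
  have d2 : (q * s) * (p' * r') = 0 :=
    le_antisymm (mul_nonpos_of_nonneg_of_nonpos c2 c3) (by linarith)
  -- in both cases, the off-diagonal product of `g * h` is positive
  rcases mul_eq_zero.1 d1 with hz | hz
  · have hp : p = 0 := (mul_eq_zero.1 hz).resolve_right hr
    subst hp
    have hqs : 0 < q * s := by linarith
    have hp' : p' = 0 :=
      (mul_eq_zero.1 ((mul_eq_zero.1 d2).resolve_left hqs.ne')).resolve_right hr'
    subst hp'
    have hqs' : q' * s' < 0 := by linarith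
    have e1 : 0 < (q' * s') * (q' * r') := mul_pos_of_neg_of_neg hqs' hh1
    have e2 : (q * s) * (s' * r') ≤ 0 := by linarith
    have e3 : s' * r' ≤ 0 := by
      by_contra! hn
      linarith [mul_pos hqs hn]
    nlinarith [mul_nonneg (sq_nonneg q') (neg_nonneg.2 e3)]
  · have hs' : s' = 0 := (mul_eq_zero.1 hz).resolve_left hq'
    subst hs'
    have hpr' : p' * r' < 0 := by linarith
    have hs : s = 0 :=
      (mul_eq_zero.1 ((mul_eq_zero.1 d2).resolve_right hpr'.ne)).resolve_left hq
    subst hs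
    have hpr : 0 < p * r := by linarith
    have e1 : 0 < (p' * r') * (q' * r') := mul_pos_of_neg_of_neg hpr' hh1
    have e2 : (p * r) * (p' * q') ≤ 0 := by linarith
    have e3 : p' * q' ≤ 0 := by
      by_contra! hn
      linarith [mul_pos hpr hn]
    nlinarith [mul_nonneg (sq_nonneg r') (neg_nonneg.2 e3)]

/-- The columns of `k` are eigenvectors of `g`, that is, zeros of a quadratic form of discriminant
`tr² g - 4`. -/
theorem exists_diagonalizing {g : SL(2, ℝ)} (hg : 4 < tr g ^ 2) :
    ∃ k : SL(2, ℝ), (k⁻¹ * g * k) 0 1 = 0 ∧ (k⁻¹ * g * k) 1 0 = 0 := by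
  have hd := det_entries g
  have hD : tr g ^ 2 - 4 = (g 1 1 - g 0 0) ^ 2 + 4 * (g 0 1 * g 1 0) := by
    rw [tr]; linear_combination 4 * hd
  suffices ∃ α β γ δ : ℝ, α * δ - β * γ = 1 ∧
      g 1 0 * β ^ 2 + (g 1 1 - g 0 0) * β * δ - g 0 1 * δ ^ 2 = 0 ∧
      g 1 0 * α ^ 2 + (g 1 1 - g 0 0) * α * γ - g 0 1 * γ ^ 2 = 0 by
    obtain ⟨α, β, γ, δ, h1, h2, h3⟩ := this
    let k : SL(2, ℝ) := ⟨!![α, β; γ, δ], by rw [Matrix.det_fin_two_of, h1]⟩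
    obtain ⟨e1, e2, e3, e4⟩ := inv_entries k
    refine ⟨k, ?_, ?_⟩
    · simp only [mul_entry, e1, e2]
      simp [k]
      linear_combination -h2
    · simp only [mul_entry, e3, e4]
      simp [k]
      linear_combination h3
  by_cases hc : g 1 0 = 0
  · have : g 1 1 - g 0 0 ≠ 0 := by
      intro h0
      rw [hc, h0] at hD
      linarith
    refine ⟨1, g 0 1 / (g 1 1 - g 0 0), 0, 1, by ring, ?_, ?_⟩
    · rw [hc]; field_simp; ring
    · rw [hc]; ring
  · have hpos : 0 < tr g ^ 2 - 4 := by linarith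
    have hq : 0 < √(tr g ^ 2 - 4) := Real.sqrt_pos.2 hpos
    have hsq : √(tr g ^ 2 - 4) ^ 2 = (g 1 1 - g 0 0) ^ 2 + 4 * (g 0 1 * g 1 0) := by
      rw [Real.sq_sqrt hpos.le, hD]
    generalize √(tr g ^ 2 - 4) = t at *
    refine ⟨(g 0 0 - g 1 1 + t) / (2 * g 1 0) * (g 1 0 / t),
      (g 0 0 - g 1 1 - t) / (2 * g 1 0), g 1 0 / t, 1, ?_, ?_, ?_⟩
    · field_simp; ring
    · field_simp; linear_combination hsq
    · field_simp; linear_combination (g 1 0) * hsq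

theorem tr_conj (k g : SL(2, ℝ)) : tr (k⁻¹ * g * k) = tr g := by
  have hk := det_entries k
  obtain ⟨e1, e2, e3, e4⟩ := inv_entries k
  simp only [tr, mul_entry, e1, e2, e3, e4]
  linear_combination (g 0 0 + g 1 1) * hk

theorem re_smul_I (g : SL(2, ℝ)) : (g • UpperHalfPlane.I).re =
    (g 0 0 * g 1 0 + g 0 1 * g 1 1) / (g 1 0 ^ 2 + g 1 1 ^ 2) := by
  rw [← UpperHalfPlane.coe_re, UpperHalfPlane.coe_specialLinearGroup_apply]
  simp [Complex.div_re, Complex.normSq_apply]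
  ring

/-- Hence, for large `R`, the points `± R + i` are far from the imaginary axis. -/
theorem abs_re_sub_re_le_cosh_dist {w : ℍ} (hw : w.im = 1) (z : ℍ) :
    |w.re - z.re| ≤ Real.cosh (dist w z) := by
  have hz := z.im_pos
  rw [UpperHalfPlane.cosh_dist, Complex.dist_eq, ← Complex.normSq_eq_norm_sq, Complex.normSq_apply]
  simp only [Complex.sub_re, Complex.sub_im, UpperHalfPlane.coe_re, UpperHalfPlane.coe_im, hw]
  rw [← sub_le_iff_le_add', le_div_iff₀ (by positivity), ← pow_two, ← sq_abs (w.re - z.re)]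
  nlinarith [sq_nonneg (|w.re - z.re| - z.im)]

theorem exists_re_pos_and_neg {Γ : Subgroup SL(2, ℝ)} {D : ℝ}
    (hD : ∀ w : ℍ, ∃ g ∈ Γ, dist w (g • UpperHalfPlane.I) ≤ D) :
    (∃ g ∈ Γ, 0 < (g • UpperHalfPlane.I).re) ∧ ∃ g ∈ Γ, (g • UpperHalfPlane.I).re < 0 := by
  have key : ∀ R : ℝ, ∃ g ∈ Γ, |R - (g • UpperHalfPlane.I).re| ≤ Real.cosh D := by
    intro R
    obtain ⟨g, hg, h⟩ := hD ⟨⟨R, 1⟩, by simp⟩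
    refine ⟨g, hg, (abs_re_sub_re_le_cosh_dist (w := ⟨⟨R, 1⟩, by simp⟩) rfl _).trans
      (Real.cosh_le_cosh.2 ?_)⟩
    rw [abs_of_nonneg dist_nonneg]
    exact h.trans (le_abs_self D)
  constructor
  · obtain ⟨g, hg, h⟩ := key (Real.cosh D + 1)
    exact ⟨g, hg, by linarith [(abs_le.1 h).2]⟩
  · obtain ⟨g, hg, h⟩ := key (-(Real.cosh D + 1))
    exact ⟨g, hg, by linarith [(abs_le.1 h).1]⟩

/-- In a subgroup that has uniformly dense orbits and no parabolic or elliptic elements, the axis of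
every hyperbolic element is crossed by another axis. -/
theorem exists_axesCross {Γ : Subgroup SL(2, ℝ)}
    (hell : ∀ g ∈ Γ, tr g ^ 2 ≤ 4 → g 0 0 = g 1 1 ∧ g 0 1 = 0 ∧ g 1 0 = 0)
    (hD : ∀ z : ℍ, ∃ D : ℝ, ∀ w : ℍ, ∃ g ∈ Γ, dist w (g • z) ≤ D)
    {g : SL(2, ℝ)} (hg : g ∈ Γ) (htr : 4 < tr g ^ 2) : ∃ h ∈ Γ, AxesCross g h := by
  obtain ⟨k, hk1, hk2⟩ := exists_diagonalizing htr
  let Γ' : Subgroup SL(2, ℝ) := Γ.comap (MulAut.conj k).toMonoidHom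
  have hmem : ∀ x, x ∈ Γ → k⁻¹ * x * k ∈ Γ' := by
    intro x hx
    have : k * (k⁻¹ * x * k) * k⁻¹ = x := by group
    simpa [Γ', this] using hx
  have hell' : ∀ x ∈ Γ', tr x ^ 2 ≤ 4 → x 0 1 = 0 ∧ x 1 0 = 0 := by
    intro x hx hx4
    have hx' : k * x * k⁻¹ ∈ Γ := hx
    have ht := tr_conj k⁻¹ x
    rw [inv_inv] at ht
    obtain ⟨h1, h2, h3⟩ := hell _ hx' (by rwa [ht])
    -- `k x k⁻¹` is scalar, hence so is `x`
    have hx2 : x = k⁻¹ * (k * x * k⁻¹) * k := by group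
    generalize k * x * k⁻¹ = y at *
    obtain ⟨e1, e2, e3, e4⟩ := inv_entries k
    rw [hx2]
    simp only [mul_entry, e1, e2, e3, e4, h1, h2, h3]
    constructor <;> ring
  obtain ⟨D, hD⟩ := hD (k • UpperHalfPlane.I)
  have hD' : ∀ w : ℍ, ∃ x ∈ Γ', dist w (x • UpperHalfPlane.I) ≤ D := by
    intro w
    obtain ⟨x, hx, h⟩ := hD (k • w)
    refine ⟨_, hmem x hx, ?_⟩
    rwa [mul_smul, mul_smul, ← dist_smul k, smul_inv_smul]
  obtain ⟨⟨x, hx, hx0⟩, ⟨y, hy, hy0⟩⟩ := exists_re_pos_and_neg hD'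
  rw [re_smul_I] at hx0 hy0
  have hden : ∀ x : SL(2, ℝ), 0 ≤ x 1 0 ^ 2 + x 1 1 ^ 2 := fun x => by positivity
  have hne : (k⁻¹ * g * k) 0 0 ^ 2 ≠ 1 := by
    intro h1
    have h2 := det_entries (k⁻¹ * g * k)
    have h3 := tr_conj k g
    rw [hk1, zero_mul, sub_zero] at h2
    rw [← h3, tr] at htr
    have h4 : (k⁻¹ * g * k) 1 1 ^ 2 = 1 := by
      have h5 := mul_pow ((k⁻¹ * g * k) 0 0) ((k⁻¹ * g * k) 1 1) 2
      rw [h2, h1, one_pow, one_mul] at h5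
      exact h5.symm
    nlinarith
  obtain ⟨b, hb, hb0⟩ := exists_mul_pos hell' (hmem g hg) hk1 hk2 hne hx hy
    (by
      by_contra! hn
      exact absurd hx0 (not_lt.2 (div_nonpos_of_nonpos_of_nonneg hn (hden x))))
    (by
      by_contra! hn
      exact absurd hy0 (not_lt.2 (div_nonneg hn (hden y))))
  refine ⟨k * b * k⁻¹, hb, axesCross_of_commDet_pos htr ?_⟩
  have : k⁻¹ * (k * b * k⁻¹) * k = b := by group
  rw [← commDet_conj k, this, commDet_of_diagonal hk1 hk2]
  have h0 : (k⁻¹ * g * k) 0 0 - (k⁻¹ * g * k) 1 1 ≠ 0 := by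
    intro h0
    apply hne
    have h2 := det_entries (k⁻¹ * g * k)
    rw [hk1, zero_mul, sub_zero, ← sub_eq_zero.1 h0] at h2
    rw [pow_two, h2]
  positivity

end Moebius

/-! ### Homotopies of closed curves -/

instance : LocallyPathConnectedSpace ℍ :=
  UpperHalfPlane.isOpenEmbedding_coe.locallyPathConnectedSpace

/-- The point `(1 - t) z + t w` of the Euclidean segment from `z` to `w`, which lies in `ℍ` because
`ℍ` is convex in `ℂ`. -/
def UpperHalfPlane.chord (t : unitInterval) (z w : ℍ) : ℍ :=
  ⟨(1 - t : ℝ) * z + (t : ℝ) * w, by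
    have hz := z.im_pos
    have hw := w.im_pos
    have h0 := t.2.1
    have h1 := t.2.2
    simp only [Complex.add_im, Complex.im_ofReal_mul]
    rcases h0.eq_or_lt with h | h
    · rw [← h]; simpa using hz
    · have := mul_pos h hw
      have := mul_nonneg (sub_nonneg.2 h1) hz.le
      simp only [UpperHalfPlane.coe_im]
      linarith⟩

theorem UpperHalfPlane.continuous_chord {X : Type*} [TopologicalSpace X] {t : X → unitInterval}
    {z w : X → ℍ} (ht : Continuous t) (hz : Continuous z) (hw : Continuous w) :
    Continuous fun x => UpperHalfPlane.chord (t x) (z x) (w x) := by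
  refine UpperHalfPlane.isOpenEmbedding_coe.isInducing.continuous_iff.2 ?_
  change Continuous fun x => ((1 - t x : ℝ) : ℂ) * z x + ((t x : ℝ) : ℂ) * w x
  have hz' := UpperHalfPlane.continuous_coe.comp hz
  have hw' := UpperHalfPlane.continuous_coe.comp hw
  simp only [Function.comp_def] at hz' hw'
  fun_prop

@[simp] theorem UpperHalfPlane.chord_zero (z w : ℍ) : UpperHalfPlane.chord 0 z w = z := by
  apply UpperHalfPlane.ext; simp [UpperHalfPlane.chord]

@[simp] theorem UpperHalfPlane.chord_one (z w : ℍ) : UpperHalfPlane.chord 1 z w = w := by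
  apply UpperHalfPlane.ext; simp [UpperHalfPlane.chord]

@[simp] theorem UpperHalfPlane.chord_self (t : unitInterval) (z : ℍ) :
    UpperHalfPlane.chord t z z = z := by
  apply UpperHalfPlane.ext; simp [UpperHalfPlane.chord]; ring

/-- A family of paths that are closed for every parameter value is a free homotopy of closed
curves. -/
theorem homotopic_of_family {S : Type*} [TopologicalSpace S] {γ₀ γ₁ : C(UnitAddCircle, S)}
    (F : ℝ → unitInterval → S) (hF : Continuous fun x : ℝ × unitInterval => F x.1 x.2)
    (h01 : F 0 = F 1) (h₀ : ∀ t ∈ Set.Ico (0 : ℝ) 1, γ₀ t = F t 0)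
    (h₁ : ∀ t ∈ Set.Ico (0 : ℝ) 1, γ₁ t = F t 1) : γ₀.Homotopic γ₁ := by
  let G : ℝ → C(unitInterval, S) := fun t => ⟨F t, hF.comp (Continuous.prodMk_right t)⟩
  have hGc : Continuous G := ContinuousMap.continuous_of_continuous_uncurry _ hF
  have hG01 : G 0 = G 1 := by
    ext s; exact congrFun h01 s
  let K : C(UnitAddCircle, C(unitInterval, S)) :=
    ⟨AddCircle.liftIco (1 : ℝ) 0 G, AddCircle.liftIco_zero_continuous hG01 hGc.continuousOn⟩
  have hK : ∀ t ∈ Set.Ico (0 : ℝ) 1, ∀ s, K t s = F t s := by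
    intro t ht s
    change AddCircle.liftIco (1 : ℝ) 0 G t s = F t s
    rw [AddCircle.liftIco_zero_coe_apply ht]
    rfl
  refine ⟨⟨⟨fun y => K y.2 y.1, ?_⟩, ?_, ?_⟩⟩
  · exact (ContinuousMap.continuous_uncurry_of_continuous K).comp continuous_swap
  · intro x
    obtain ⟨t, ht, rfl⟩ := AddCircle.eq_coe_Ico x
    exact (hK t ht 0).trans (h₀ t ht).symm
  · intro x
    obtain ⟨t, ht, rfl⟩ := AddCircle.eq_coe_Ico x
    exact (hK t ht 1).trans (h₁ t ht).symm

/-! ### The deck group of a compact hyperbolic surface -/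

namespace HyperbolicStructure

variable {S : Type*} [TopologicalSpace S] (Sig : HyperbolicStructure S)

/-- The matrices in `SL(2, ℝ)` that act on `ℍ` as deck transformations; it contains `-1`. -/
def deckGroup : Subgroup SL(2, ℝ) where
  carrier := {g | ∀ z : ℍ, Sig.proj (g • z) = Sig.proj z}
  one_mem' := fun z => by rw [one_smul]
  mul_mem' := fun {g h} hg hh z => by rw [mul_smul, hg, hh]
  inv_mem' := fun {g} hg z => by rw [← hg (g⁻¹ • z), smul_inv_smul]

/-- The covering `ℍ → S` is regular, as `ℍ` is simply connected. -/
theorem exists_deck_smul_eq {z w : ℍ} (h : Sig.proj z = Sig.proj w) :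
    ∃ g ∈ Sig.deckGroup, g • z = w := by
  have cov := Sig.isCoveringMap_proj
  obtain ⟨F, ⟨hF0, hF⟩, -⟩ := cov.existsUnique_continuousMap_lifts Sig.proj z w h.symm
  obtain ⟨G, ⟨hG0, hG⟩, -⟩ := cov.existsUnique_continuousMap_lifts Sig.proj w z h
  have hGF : G ∘ F = id := cov.eq_of_comp_eq (G.continuous.comp F.continuous) continuous_id
    (by rw [← Function.comp_assoc, hG, hF, Function.comp_id]) z (by simp [hF0, hG0])
  have hFG : F ∘ G = id := cov.eq_of_comp_eq (F.continuous.comp G.continuous) continuous_id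
    (by rw [← Function.comp_assoc, hF, hG, Function.comp_id]) w (by simp [hF0, hG0])
  let T : ℍ ≃ₜ ℍ :=
    { toFun := F
      invFun := G
      left_inv := congrFun hGF
      right_inv := congrFun hFG
      continuous_toFun := F.continuous
      continuous_invFun := G.continuous }
  obtain ⟨g, hg⟩ := Sig.deck_eq_moebius T (congrFun hF)
  exact ⟨g, fun x => by rw [← hg]; exact congrFun hF x, by rw [← hg]; exact hF0⟩

theorem exists_dist_deck_le [CompactSpace S] (z : ℍ) :
    ∃ D : ℝ, ∀ w : ℍ, ∃ g ∈ Sig.deckGroup, dist w (g • z) ≤ D := by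
  obtain ⟨n, hn⟩ : ∃ n : ℕ, Set.univ ⊆ Sig.proj '' Metric.ball z n := by
    refine isCompact_univ.elim_directed_cover (fun n : ℕ => Sig.proj '' Metric.ball z n)
      (fun n => Sig.isCoveringMap_proj.isOpenMap _ Metric.isOpen_ball) ?_ ?_
    · intro x _
      obtain ⟨w, rfl⟩ := Sig.surjective_proj x
      obtain ⟨n, hn⟩ := exists_nat_gt (dist w z)
      exact Set.mem_iUnion.2 ⟨n, w, hn, rfl⟩
    · refine Monotone.directed_le fun m n hmn => Set.image_mono (Metric.ball_subset_ball ?_)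
      exact_mod_cast hmn
  refine ⟨n, fun w => ?_⟩
  obtain ⟨y, hy, hyw⟩ := hn (Set.mem_univ (Sig.proj w))
  obtain ⟨g, hg, rfl⟩ := Sig.exists_deck_smul_eq hyw
  exact ⟨g, hg, by rw [dist_smul]; exact (Metric.mem_ball.1 hy).le⟩

/-- A positive lower bound for the injectivity radius of the compact surface `S`. -/
theorem exists_pos_of_dist_lt [CompactSpace S] :
    ∃ ε > 0, ∀ g ∈ Sig.deckGroup, ∀ z : ℍ, dist z (g • z) < ε → g • z = z := by
  obtain ⟨D, hD⟩ := Sig.exists_dist_deck_le UpperHalfPlane.I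
  have hinj := Sig.isCoveringMap_proj.isLocalHomeomorph.isLocallyInjective
  choose U hU hxU hUinj using hinj
  obtain ⟨ε, hε, h⟩ := lebesgue_number_lemma_of_metric
    (isCompact_closedBall (UpperHalfPlane.I : ℍ) D) hU
    (fun x _ => Set.mem_iUnion.2 ⟨x, hxU x⟩)
  refine ⟨ε, hε, fun g hg z hz => ?_⟩
  obtain ⟨k, hk, hkz⟩ := hD z
  -- move `z` into the compact ball
  obtain ⟨i, hi⟩ := h (k⁻¹ • z) (by
    rw [Metric.mem_closedBall, ← dist_smul k, smul_inv_smul]; exact hkz)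
  have h1 : k⁻¹ • g • z = k⁻¹ • z := by
    refine hUinj i (hi ?_) (hi (Metric.mem_ball_self hε)) ?_
    · rw [Metric.mem_ball, dist_smul, dist_comm]; exact hz
    · rw [Sig.deckGroup.inv_mem hk, Sig.deckGroup.inv_mem hk, hg]
  exact (smul_left_cancel_iff _).1 h1

theorem smul_eq_self_of_fixed {g : SL(2, ℝ)} (hg : g ∈ Sig.deckGroup) {z : ℍ} (hz : g • z = z)
    (w : ℍ) : g • w = w :=
  congrFun (Sig.isCoveringMap_proj.eq_of_comp_eq (continuous_const_smul g) continuous_id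
    (funext hg) z hz) w

theorem smul_eq_self_of_tr [CompactSpace S] {g : SL(2, ℝ)} (hg : g ∈ Sig.deckGroup)
    (htr : Moebius.tr g ^ 2 ≤ 4) (w : ℍ) : g • w = w := by
  obtain ⟨ε, hε, h⟩ := Sig.exists_pos_of_dist_lt
  obtain ⟨z, hz⟩ := Moebius.exists_displacement_lt htr hε
  exact Sig.smul_eq_self_of_fixed hg (h g hg z hz) w

end HyperbolicStructure

theorem Moebius.scalar_of_smul_eq_self {g : SL(2, ℝ)} (h : ∀ w : ℍ, g • w = w) :
    g 0 0 = g 1 1 ∧ g 0 1 = 0 ∧ g 1 0 = 0 := by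
  have key : ∀ w : ℍ, g 0 0 * (w : ℂ) + g 0 1 = w * (g 1 0 * w + g 1 1) := by
    intro w
    have hden : (g 1 0 : ℂ) * w + g 1 1 ≠ 0 := by
      have := UpperHalfPlane.denom_ne_zero (g : GL (Fin 2) ℝ) w
      simpa [UpperHalfPlane.denom] using this
    have h1 := congrArg ((↑) : ℍ → ℂ) (h w)
    rw [UpperHalfPlane.coe_specialLinearGroup_apply, div_eq_iff (by simpa using hden)] at h1
    simpa using h1
  have h1 := key UpperHalfPlane.I
  have h2 := key ⟨⟨0, 2⟩, by simp⟩
  have r1 := congrArg Complex.re h1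
  have i1 := congrArg Complex.im h1
  have r2 := congrArg Complex.re h2
  simp at r1 i1 r2
  exact ⟨i1, by linarith, by linarith⟩

/-! ### Closed curves and deck transformations -/

namespace HyperbolicStructure

variable {S : Type*} [TopologicalSpace S] (Sig : HyperbolicStructure S)

/-- The closed curve `γ` has a lift to `ℍ`, defined on `[0, 1]`, whose endpoint is the image of its
initial point under `g`. Values of `σ` outside `[0, 1]` play no role. -/
def Represents (g : SL(2, ℝ)) (γ : C(UnitAddCircle, S)) : Prop :=
  ∃ σ : ℝ → ℍ, Continuous σ ∧ (∀ t ∈ Set.Icc (0 : ℝ) 1, Sig.proj (σ t) = γ t) ∧ σ 1 = g • σ 0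

/-- The closed curve covered by the Euclidean segment from `z` to `g z`. -/
def standardLoop (g : Sig.deckGroup) (z : ℍ) : C(UnitAddCircle, S) where
  toFun := AddCircle.liftIco 1 0
    fun t => Sig.proj (UpperHalfPlane.chord (Set.projIcc (0 : ℝ) 1 zero_le_one t) z (g.1 • z))
  continuous_toFun := by
    refine AddCircle.liftIco_zero_continuous (by simp [g.2 z]) (Continuous.continuousOn ?_)
    exact Sig.proj.continuous.comp (UpperHalfPlane.continuous_chord
      continuous_projIcc continuous_const continuous_const)

theorem standardLoop_apply (g : Sig.deckGroup) (z : ℍ) {t : ℝ} (ht : t ∈ Set.Ico (0 : ℝ) 1) :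
    Sig.standardLoop g z t =
      Sig.proj (UpperHalfPlane.chord (Set.projIcc (0 : ℝ) 1 zero_le_one t) z (g.1 • z)) :=
  AddCircle.liftIco_zero_coe_apply (f := fun t : ℝ =>
    Sig.proj (UpperHalfPlane.chord (Set.projIcc (0 : ℝ) 1 zero_le_one t) z (g.1 • z))) ht

theorem standardLoop_homotopic (g : Sig.deckGroup) (z w : ℍ) :
    (Sig.standardLoop g z).Homotopic (Sig.standardLoop g w) := by
  refine homotopic_of_family (fun t s => Sig.proj (UpperHalfPlane.chord
    (Set.projIcc (0 : ℝ) 1 zero_le_one t) (UpperHalfPlane.chord s z w) (g.1 • UpperHalfPlane.chord s z w))) ?_ ?_ ?_ ?_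
  · have h1 : Continuous fun x : ℝ × unitInterval => UpperHalfPlane.chord x.2 z w :=
      UpperHalfPlane.continuous_chord continuous_snd continuous_const continuous_const
    exact Sig.proj.continuous.comp (UpperHalfPlane.continuous_chord
      (continuous_projIcc.comp continuous_fst) h1 (h1.const_smul g.1))
  · funext s; simp [g.2 _]
  · intro t ht; simp [Sig.standardLoop_apply g z ht]
  · intro t ht; simp [Sig.standardLoop_apply g w ht]

theorem Represents.homotopic_standardLoop {g : Sig.deckGroup} {γ : C(UnitAddCircle, S)}
    (h : Sig.Represents g γ) (z : ℍ) : γ.Homotopic (Sig.standardLoop g z) := by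
  obtain ⟨σ, hσ, hγ, h1⟩ := h
  refine ContinuousMap.Homotopic.trans ?_ (Sig.standardLoop_homotopic g (σ 0) z)
  refine homotopic_of_family (fun t s => Sig.proj (UpperHalfPlane.chord s (σ t)
    (UpperHalfPlane.chord (Set.projIcc (0 : ℝ) 1 zero_le_one t) (σ 0) (g.1 • σ 0)))) ?_ ?_ ?_ ?_
  · have h1 : Continuous fun x : ℝ × unitInterval =>
        UpperHalfPlane.chord (Set.projIcc (0 : ℝ) 1 zero_le_one x.1) (σ 0) (g.1 • σ 0) :=
      UpperHalfPlane.continuous_chord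
        (continuous_projIcc.comp continuous_fst) continuous_const continuous_const
    exact Sig.proj.continuous.comp (UpperHalfPlane.continuous_chord
      continuous_snd (hσ.comp continuous_fst) h1)
  · funext s; simp [h1, g.2 _]
  · intro t ht; simp [hγ t ⟨ht.1, ht.2.le⟩]
  · intro t ht; simp [Sig.standardLoop_apply g _ ht]

/-- The oriented closed curve (free homotopy class) determined by the deck transformation `g`. -/
def closedCurve (g : Sig.deckGroup) : OrientedMultiCurve S :=
  OrientedMultiCurve.ofLoop (Sig.standardLoop g UpperHalfPlane.I)

theorem Represents.ofLoop_eq {g : Sig.deckGroup} {γ : C(UnitAddCircle, S)}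
    (h : Sig.Represents g γ) : OrientedMultiCurve.ofLoop γ = Sig.closedCurve g :=
  OrientedMultiCurve.ofLoop_eq_of_homotopic (h.homotopic_standardLoop Sig _)

/-- The lift to `ℝ` of a closed curve is equivariant under some deck transformation `g`, so that
its restriction to `[0, n]` ends at the image of its initial point under `g ^ n`. -/
theorem exists_represents_pow (γ : C(UnitAddCircle, S)) :
    ∃ g : Sig.deckGroup, ∀ n : ℕ,
      Sig.Represents (g ^ n : Sig.deckGroup) (γ.comp (OrientedMultiCurve.circlePow n)) := by
  have cov := Sig.isCoveringMap_proj
  obtain ⟨z, hz⟩ := Sig.surjective_proj (γ 0)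
  let γ' : C(ℝ, S) := ⟨fun t => γ t, γ.continuous.comp (AddCircle.continuous_mk' 1)⟩
  obtain ⟨σ, ⟨hσ0, hσ⟩, -⟩ := cov.existsUnique_continuousMap_lifts γ' 0 z (by simpa [γ'] using hz)
  have hσ' : ∀ t : ℝ, Sig.proj (σ t) = γ t := congrFun hσ
  have hper : ∀ t : ℝ, ((t + 1 : ℝ) : UnitAddCircle) = t := fun t => AddCircle.coe_add_period 1 t
  obtain ⟨g, hg, hg1⟩ := Sig.exists_deck_smul_eq (z := σ 0) (w := σ 1) (by
    rw [hσ', hσ', ← hper 0, zero_add])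
  have hshift : (fun t => σ (t + 1)) = fun t => g • σ t := by
    refine cov.eq_of_comp_eq (by fun_prop) (σ.continuous.const_smul g) (funext fun t => ?_) 0
      (by simp [hg1])
    change Sig.proj (σ (t + 1)) = Sig.proj (g • σ t)
    rw [hg, hσ', hσ', hper]
  have hn : ∀ n : ℕ, σ n = g ^ n • σ 0 := by
    intro n
    induction n with
    | zero => simp
    | succ n ih => rw [Nat.cast_succ, congrFun hshift n, ih, pow_succ', mul_smul]
  refine ⟨⟨g, hg⟩, fun n => ⟨fun t => σ (n * t), by fun_prop, fun t _ => ?_, ?_⟩⟩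
  · rw [hσ']
    change γ _ = γ (n • (t : UnitAddCircle))
    rw [← nsmul_eq_mul, AddCircle.coe_nsmul]
  · simp [hn]

theorem represents_circleOfPath {g : SL(2, ℝ)} {x : S} (p : Path x x) {z : ℍ} (q : Path z (g • z))
    (h : ∀ t, Sig.proj (q t) = p t) : Sig.Represents g (OrientedMultiCurve.circleOfPath p) := by
  refine ⟨q.extend, q.continuous_extend, ?_, by simp⟩
  have key : ∀ t ∈ Set.Ico (0 : ℝ) 1,
      Sig.proj (q.extend t) = OrientedMultiCurve.circleOfPath p t := by
    intro t ht
    refine Eq.trans ?_ (AddCircle.liftIco_zero_coe_apply (f := p.extend) ht).symm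
    exact h _
  intro t ht
  rcases ht.2.eq_or_lt with rfl | h1
  · have h0 : Sig.proj (q.extend 1) = Sig.proj (q.extend 0) := by
      have e0 := h 0
      have e1 := h 1
      rw [p.source, q.source] at e0
      rw [p.target, q.target] at e1
      rw [q.extend_zero, q.extend_one, e0, e1]
    have h1 : ((1 : ℝ) : UnitAddCircle) = (0 : ℝ) := AddCircle.coe_period 1
    rw [h0, h1, key 0 (by simp)]
  · exact key t ⟨ht.1, h1⟩

/-- The product of `a` and `b` in `FundamentalGroup` runs along `b` first, which is why it corresponds
to `h * g`. -/
theorem crosses_of_axesCross (z₀ : ℍ) {g h : Sig.deckGroup} (H : Moebius.AxesCross g.1 h.1) :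
    ∃ a b : FundamentalGroup S (Sig.proj z₀), Sig.Crosses z₀ a b ∧
      OrientedMultiCurve.ofFundamentalGroup a = Sig.closedCurve g ∧
      OrientedMultiCurve.ofFundamentalGroup b = Sig.closedCurve h ∧
      OrientedMultiCurve.ofFundamentalGroup (a * b) = Sig.closedCurve (h * g) := by
  let q : ∀ g : Sig.deckGroup, Path z₀ (g.1 • z₀) := fun g => PathConnectedSpace.somePath _ _
  let p : ∀ g : Sig.deckGroup, Path (Sig.proj z₀) (Sig.proj z₀) := fun g =>
    ((q g).map Sig.proj.continuous).cast rfl (g.2 z₀).symm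
  let a : Sig.deckGroup → FundamentalGroup S (Sig.proj z₀) := fun g =>
    FundamentalGroup.fromPath (Path.Homotopic.Quotient.mk (p g))
  have hrep : ∀ g, OrientedMultiCurve.ofFundamentalGroup (a g) = Sig.closedCurve g := fun g =>
    (Sig.represents_circleOfPath (p g) (q g) fun _ => rfl).ofLoop_eq
  have hdeck : ∀ g, Sig.IsDeckTransformationOf z₀ (a g) (Homeomorph.smul g.1) :=
    fun g => ⟨fun z => g.2 z, q g, rfl⟩
  refine ⟨a g, a h, ⟨_, _, hdeck g, hdeck h, H.axes_inter⟩, hrep g, hrep h, ?_⟩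
  let r : Path z₀ ((h * g).1 • z₀) :=
    ((q h).trans ((q g).map (continuous_const_smul h.1))).cast rfl
      (by rw [Subgroup.coe_mul, mul_smul])
  have hr : ∀ t, Sig.proj (r t) = ((p h).trans (p g)) t := by
    intro t
    change Sig.proj (((q h).trans ((q g).map (continuous_const_smul h.1))) t) = _
    rw [Path.trans_apply, Path.trans_apply]
    split_ifs with ht
    · rfl
    · exact h.2 _
  exact (Sig.represents_circleOfPath ((p h).trans (p g)) r hr).ofLoop_eq

theorem closedCurve_eq_zero {g : Sig.deckGroup} (hg : ∀ z : ℍ, g.1 • z = z) :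
    Sig.closedCurve g = 0 := by
  refine (AddCon.eq _).2 (AddConGen.Rel.of _ _ (MultiCurveMove.drop _ ?_))
  refine ⟨Sig.proj UpperHalfPlane.I, ?_⟩
  have : Sig.standardLoop g UpperHalfPlane.I =
      ContinuousMap.const _ (Sig.proj UpperHalfPlane.I) := by
    ext x
    obtain ⟨t, ht, rfl⟩ := AddCircle.eq_coe_Ico x
    simp [Sig.standardLoop_apply g _ ht, hg]
  rw [this]

theorem exists_deck_axesCross [CompactSpace S] {g : SL(2, ℝ)} (hg : g ∈ Sig.deckGroup)
    (htr : 4 < Moebius.tr g ^ 2) : ∃ h ∈ Sig.deckGroup, Moebius.AxesCross g h :=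
  Moebius.exists_axesCross
    (fun _ hx hx4 => Moebius.scalar_of_smul_eq_self (Sig.smul_eq_self_of_tr hx hx4))
    Sig.exists_dist_deck_le hg htr

end HyperbolicStructure

/-! ### Curve functionals -/

theorem le_of_forall_succ_mul_le {x y c : ℝ} (h : ∀ m : ℕ, (m + 1) * x ≤ (m + 1) * y + c) :
    x ≤ y := by
  by_contra! hlt
  obtain ⟨m, hm⟩ := exists_nat_gt (c / (x - y))
  rw [div_lt_iff₀ (sub_pos.2 hlt)] at hm
  linarith [h m]

namespace CurveFunctional

open OrientedMultiCurve

variable {S : Type*} [TopologicalSpace S] {f : OrientedMultiCurve S → ℝ}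

theorem Additive.map_zero (h_add : Additive f) : f 0 = 0 := by
  have := h_add 0 0
  rw [add_zero] at this
  linarith

theorem power_ofLoop (n : ℕ) (γ : C(UnitAddCircle, S)) :
    power n (ofLoop γ) = ofLoop (γ.comp (circlePow n)) := rfl

theorem power_one_ofLoop (γ : C(UnitAddCircle, S)) : power 1 (ofLoop γ) = ofLoop γ := by
  rw [power_ofLoop]
  congr 1
  ext x
  simp [circlePow]

theorem SubStable.mul_le {C : OrientedMultiCurve S} (h_sub : SubStable f) (n : ℕ) :
    (n + 1) * f (power 1 C) ≤ f (power (n + 1) C) := by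
  induction n with
  | zero => simp
  | succ n ih =>
    have := h_sub C 1 (n + 1)
    push_cast
    linarith

theorem OrientedDisconnectedSmoothing.le_add {Sig : HyperbolicStructure S} {z₀ : ℍ}
    (h_add : Additive f) (h_smooth : OrientedDisconnectedSmoothing Sig z₀ f)
    {g h : Sig.deckGroup} (H : Moebius.AxesCross g.1 h.1) :
    f (Sig.closedCurve (g * h)) ≤ f (Sig.closedCurve g) + f (Sig.closedCurve h) := by
  obtain ⟨a, b, hab, ha, hb, hmul⟩ := Sig.crosses_of_axesCross z₀ H.symm
  have := h_smooth a b hab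
  rw [h_add, ha, hb, hmul] at this
  linarith

/-- The bound `f [gⁿ] ≤ n f [g] + c`, with `c = f [h] + f [h⁻¹]` for any `h` whose axis crosses that
of `g`. -/
theorem exists_pow_le [CompactSpace S] {Sig : HyperbolicStructure S} {z₀ : ℍ}
    (h_add : Additive f) (h_smooth : OrientedDisconnectedSmoothing Sig z₀ f)
    {g : Sig.deckGroup} (htr : 4 < Moebius.tr g.1 ^ 2) :
    ∃ c : ℝ, ∀ n : ℕ, f (Sig.closedCurve (g ^ (n + 1))) ≤ (n + 1) * f (Sig.closedCurve g) + c := by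
  obtain ⟨h, hh, H⟩ := Sig.exists_deck_axesCross g.2 htr
  lift h to Sig.deckGroup using hh
  have hup : ∀ k : ℕ, f (Sig.closedCurve (g ^ k * h)) ≤
      k * f (Sig.closedCurve g) + f (Sig.closedCurve h) := by
    intro k
    induction k with
    | zero => simp
    | succ k ih =>
      have := h_smooth.le_add h_add (g := g) (h := g ^ k * h) (by simpa using H.pow_mul k)
      rw [← mul_assoc, ← pow_succ'] at this
      push_cast
      linarith
  refine ⟨f (Sig.closedCurve h) + f (Sig.closedCurve h⁻¹), fun n => ?_⟩
  have h1 := h_smooth.le_add h_add (g := g ^ (n + 1) * h) (h := h⁻¹)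
    (by simpa using H.pow_mul_inv n)
  rw [mul_inv_cancel_right] at h1
  have h2 := hup (n + 1)
  push_cast at h2
  linarith

theorem power_ofLoop_eq [CompactSpace S] {Sig : HyperbolicStructure S} {z₀ : ℍ}
    (h_add : Additive f) (h_sub : SubStable f)
    (h_smooth : OrientedDisconnectedSmoothing Sig z₀ f) (γ : C(UnitAddCircle, S)) (n : ℕ) :
    f (power (n + 1) (ofLoop γ)) = (n + 1) * f (ofLoop γ) := by
  obtain ⟨g, hg⟩ := Sig.exists_represents_pow γ
  have hpow : ∀ k, power k (ofLoop γ) = Sig.closedCurve (g ^ k) := fun k => (hg k).ofLoop_eq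
  have hone : ofLoop γ = Sig.closedCurve g := by rw [← power_one_ofLoop, hpow, pow_one]
  rw [hpow, hone]
  rcases le_or_gt (Moebius.tr g.1 ^ 2) 4 with htr | htr
  · have hfix := Sig.smul_eq_self_of_tr g.2 htr
    have hfix' : ∀ z : ℍ, (g ^ (n + 1)).1 • z = z := by
      intro z
      have : g.1 ∈ MulAction.stabilizer SL(2, ℝ) z := hfix z
      exact pow_mem this (n + 1)
    rw [Sig.closedCurve_eq_zero hfix, Sig.closedCurve_eq_zero hfix', h_add.map_zero, mul_zero]
  · obtain ⟨c, hc⟩ := exists_pow_le h_add h_smooth htr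
    refine le_antisymm (le_of_forall_succ_mul_le (c := c) fun m => ?_) ?_
    · -- compare the `(n + 1) (m + 1)`-st power with its two bounds
      have h1 := h_sub.mul_le (C := Sig.closedCurve (g ^ (n + 1))) m
      have e : ∀ k, power k (Sig.closedCurve (g ^ (n + 1))) =
          Sig.closedCurve (g ^ ((n + 1) * k)) := by
        intro k
        rw [← hpow, ← hpow, power_ofLoop, power_ofLoop, power_ofLoop]
        congr 1
        ext x
        simp [circlePow, mul_smul]
      rw [e, e, mul_one] at h1
      have h2 := hc (n * m + n + m)
      rw [show n * m + n + m + 1 = (n + 1) * (m + 1) by ring] at h2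
      push_cast at h2
      linarith
    · have := h_sub.mul_le (C := ofLoop γ) n
      rwa [hpow, hpow, pow_one] at this

end CurveFunctional

end

theorem mainTheorem12 {S : Type*} [TopologicalSpace S] [T2Space S] [CompactSpace S]
    (Sig : HyperbolicStructure S) (z₀ : ℍ)
    (f : OrientedMultiCurve S → ℝ)
    (h_add : CurveFunctional.Additive f)
    (h_sub : CurveFunctional.SubStable f)
    (h_smooth : CurveFunctional.OrientedDisconnectedSmoothing Sig z₀ f) :
    CurveFunctional.Stable f ∧
      ∀ (C : OrientedMultiCurve S) (n : ℕ), 0 < n →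
        f (OrientedMultiCurve.power n C) = n * f C := by
  have main : ∀ (C : OrientedMultiCurve S) (n : ℕ), 0 < n →
      f (OrientedMultiCurve.power n C) = n * f C := by
    intro C n hn
    obtain ⟨n, rfl⟩ := Nat.exists_eq_succ_of_ne_zero hn.ne'
    induction C using AddCon.induction_on with
    | _ M =>
      induction M using Multiset.induction with
      | empty =>
        change f (OrientedMultiCurve.power (n + 1) 0) = _ * f 0
        rw [map_zero, h_add.map_zero, mul_zero]
      | cons γ M ih =>
        change f (OrientedMultiCurve.power (n + 1)
          (OrientedMultiCurve.ofLoop γ + (M : (multiCurveCon S).Quotient))) =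
            _ * f (OrientedMultiCurve.ofLoop γ + (M : (multiCurveCon S).Quotient))
        rw [map_add, h_add, h_add, CurveFunctional.power_ofLoop_eq h_add h_sub h_smooth, ih]
        push_cast
        ring
  refine ⟨fun C n hn => ?_, main⟩
  let F : OrientedMultiCurve S →+ ℝ := ⟨⟨f, h_add.map_zero⟩, h_add⟩
  rw [main C n hn, ← nsmul_eq_mul]
  exact (map_nsmul F n C).symm
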